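/- Let $1\le s\le n$ be integers and let $C\in\mathbb R^{n\times n}$ be symmetric positive definite with smallest eigenvalue $\lambda_{\min}(C)>0$. For $0\le t\le\lambda_{\min}(C)$ let $A(t)\in\mathbb R^{n\times n}$ be a matrix with $C-tI=A(t)^\top A(t)$, with columns $a_1(t),\dots,a_n(t)$, and put $\mathcal M_t(x)=\sum_{i=1}^n x_i\,a_i(t)a_i(t)^\top$ for $x\in[0,1]^n$. For a symmetric positive semidefinite $n\times n$ matrix $X$ with eigenvalues $\lambda_1(X)\ge\dots\ge\lambda_n(X)$ let $\Phi_s(X;t)=\sum_{i=1}^s\log(\lambda_i(X)+t)$ (with $\log 0=-\infty$), and let $\widehat\Phi_s(\,\cdot\,;t)$ be the concave envelope of $\Phi_s(\,\cdot\,;t)$ on the cone of positive semidefinite matrices, i.e. the pointwise infimum of all concave functions that lie above it. Let $$\hat z(t)=\max\Big\{\widehat\Phi_s(\mathcal M_t(x);t):\ x\in[0,1]^n,\ \sum_{i=1}^n x_i=s\Big\}.$$ Let $x^*$ be an optimal solution of this problem at $t=\lambda_{\min}(C)$, let $x^{*\downarrow}_1\ge\dots\ge x^{*\downarrow}_n$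 be its entries in nonincreasing order, and let $\beta^*_1\ge\dots\ge\beta^*_n$ be the eigenvalues of $\mathcal M_0(x^*)$. Let $k$, $0\le k\le s-1$, be an integer with $$\beta^*_k>\frac1{s-k}\sum_{i=k+1}^n\beta^*_i\ge\beta^*_{k+1},\qquad\text{where }\beta^*_0=\infty .$$ Then: (i) $\displaystyle \hat z(0)-\hat z(\lambda_{\min}(C))\ \ge\ \Delta^{lb}:=\lambda_{\min}(C)\Big(k-\sum_{i=1}^k x^{*\downarrow}_i\Big)\Big(\frac{s-k}{\sum_{i=k+1}^n\beta^*_i}-\frac1{\beta^*_k}\Big)\ \ge\ 0$, where $1/\beta^*_0=0$; (ii) if $k\ge1$ and $x^{*\downarrow}_k<1$, then $\hat z(0)>\hat z(\lambda_{\min}(C))$. -/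

import Mathlib

namespace AugFact

/-- The `i`-th entry, counted from `1`, of a vector in `ℝⁿ`; it is `0` outside `1, …, n`. -/
noncomputable def nth {n : ℕ} (y : Fin n → ℝ) (i : ℕ) : ℝ :=
  if h : 1 ≤ i ∧ i ≤ n then y ⟨i - 1, by omega⟩ else 0

/-- The rearrangement of a vector in nonincreasing order. -/
noncomputable def desc {n : ℕ} (y : Fin n → ℝ) : Fin n → ℝ :=
  fun i => y (Tuple.sort (fun j => -y j) i)

open Classical in
/-- The vector of eigenvalues, with multiplicity and in nonincreasing order, of a symmetric
matrix (the zero vector for a matrix that is not symmetric). -/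
noncomputable def eigs {n : ℕ} (X : Matrix (Fin n) (Fin n) ℝ) : Fin n → ℝ :=
  if h : X.IsHermitian then
    fun i => h.eigenvalues₀ (Fin.cast (Fintype.card_fin n).symm i)
  else 0

/-- The smallest eigenvalue of a symmetric `n × n` matrix. -/
noncomputable def lambdaMin {n : ℕ} (X : Matrix (Fin n) (Fin n) ℝ) : ℝ :=
  nth (eigs X) n

/-- `Φ_s(X; t) = ∑_{i ≤ s} log (λ_i(X) + t)`, with `log 0 = -∞`. -/
noncomputable def Phi {n : ℕ} (s : ℕ) (t : ℝ) (X : Matrix (Fin n) (Fin n) ℝ) : EReal :=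
  ∑ i ∈ Finset.Icc 1 s, ENNReal.log (ENNReal.ofReal (nth (eigs X) i + t))

/-- The concave envelope, on the cone of positive semidefinite matrices, of an extended real
valued function: the pointwise infimum of all concave functions that lie above it. -/
noncomputable def concaveEnvelope {n : ℕ} (f : Matrix (Fin n) (Fin n) ℝ → EReal)
    (X : Matrix (Fin n) (Fin n) ℝ) : EReal :=
  ⨅ h ∈ {h : Matrix (Fin n) (Fin n) ℝ → ℝ |
      ConcaveOn ℝ {Y : Matrix (Fin n) (Fin n) ℝ | Y.PosSemidef} h ∧
      ∀ Y : Matrix (Fin n) (Fin n) ℝ, Y.PosSemidef → f Y ≤ (h Y : EReal)},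
    (h X : EReal)

/-- `∑_i x_i a_i a_iᵀ`, where `a_i` is the `i`-th column of `A`. -/
def weightedGram {n : ℕ} (A : Matrix (Fin n) (Fin n) ℝ) (x : Fin n → ℝ) :
    Matrix (Fin n) (Fin n) ℝ :=
  ∑ i, x i • Matrix.vecMulVec (fun j => A j i) (fun j => A j i)

/-- The vectors in `[0,1]ⁿ` with coordinate sum `s`. -/
def feasible (n s : ℕ) : Set (Fin n → ℝ) :=
  {x | (∀ i, 0 ≤ x i ∧ x i ≤ 1) ∧ ∑ i, x i = (s : ℝ)}

/-- The objective of the augmented factorization relaxation with parameter `t`, where `A` is the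
factor of `C - t I`. -/
noncomputable def objective {n : ℕ} (s : ℕ) (A : Matrix (Fin n) (Fin n) ℝ) (t : ℝ)
    (x : Fin n → ℝ) : EReal :=
  concaveEnvelope (Phi s t) (weightedGram A x)

/-- The augmented factorization bound: the optimal value of the relaxation. -/
noncomputable def bound {n : ℕ} (s : ℕ) (A : Matrix (Fin n) (Fin n) ℝ) (t : ℝ) : EReal :=
  ⨆ x ∈ feasible n s, objective s A t x

/-- `x` is an optimal solution of the relaxation. -/
def IsOptimal {n : ℕ} (s : ℕ) (A : Matrix (Fin n) (Fin n) ℝ) (t : ℝ) (x : Fin n → ℝ) : Prop :=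
  x ∈ feasible n s ∧ IsMaxOn (objective s A t) (feasible n s) x

/-- `∑_{i = k+1}^{n} y_i`. -/
noncomputable def tailSum {n : ℕ} (y : Fin n → ℝ) (k : ℕ) : ℝ :=
  ∑ i ∈ Finset.Icc (k + 1) n, nth y i

/-- For a nonincreasing vector `y`: the integer `k` satisfies `0 ≤ k ≤ s - 1` and
`y_k > (1 / (s - k)) ∑_{i > k} y_i ≥ y_{k+1}`, where `y_0 = ∞`. -/
def IsIndex {n : ℕ} (s : ℕ) (y : Fin n → ℝ) (k : ℕ) : Prop :=
  k < s ∧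
  (1 ≤ k → 1 / ((s : ℝ) - k) * tailSum y k < nth y k) ∧
  nth y (k + 1) ≤ 1 / ((s : ℝ) - k) * tailSum y k

/-- `l (k - ∑_{i ≤ k} x↓_i) ((s - k) / ∑_{i > k} β_i - 1 / β_k)`. For `k = 0` the last fraction
is `0`, in agreement with `β_0 = ∞`. -/
noncomputable def deltaLb {n : ℕ} (s k : ℕ) (l : ℝ) (x β : Fin n → ℝ) : ℝ :=
  l * ((k : ℝ) - ∑ i ∈ Finset.Icc 1 k, nth (desc x) i) *
    (((s : ℝ) - k) / tailSum β k - 1 / nth β k)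

end AugFact

namespace AugFact
open Matrix

/-! Put t = λ_min(C), X = diag(x*), B = √X C √X, let m be the tail mean of β* and L = Σ_{i≤k} log
β_i + (s-k) log m. By cyclicity of the characteristic polynomial, M_0(x*) has the spectrum of B and
M_t(x*) that of B - tX.

Lower bound: x* is feasible at parameter 0, and β is a doubly stochastic image of ν = (β_1,…,β_k,
m,…,m, 0,…,0). By Birkhoff's theorem M_0(x*) is a convex combination of matrices with spectrum ν, on
each of which Φ_s equals L; so ẑ(0) ≥ L (`le_concaveEnvelope_Phi_zero`).

Upper bound: log u ≤ -log w + uw - 1 and von Neumann's trace inequality give affine majorants of Φ_s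
(`concaveEnvelope_Phi_le`). Take w_i = 1/β_i for i ≤ k and 1/m otherwise, and apply the trace
inequality once more in the eigenbasis of B: ẑ(t) ≤ L - t(Σ y_i w_i - Σ_{i≤s} w_i), where the y_i
are the Rayleigh quotients of X along the eigenvectors of B. As Σ y_i = s, the bracket is Σ_{i≤k}
(1/m - 1/β_i)(1 - y_i) (`mul_slope_sum_gap`), and Ky Fan's principle (`sum_rayleigh_le_sum_desc`)
bounds t times it below by Δ^{lb}. -/

/-! ### Indexing and ordered spectra -/

theorem sum_Icc_nth {n m : ℕ} (a : ℕ) (hm : m ≤ n) (y : Fin n → ℝ)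
    {M : Type*} [AddCommMonoid M] (f : ℝ → M) :
    ∑ i ∈ Finset.Icc (a + 1) m, f (nth y i)
      = ∑ i : Fin n, if a ≤ i.val ∧ i.val < m then f (y i) else 0 := by
  rw [← Finset.sum_filter]
  symm
  -- `nth` counts from 1 and `Fin n` from 0, hence the shift.
  refine Finset.sum_bij (fun i _ => i.val + 1) ?_ ?_ ?_ ?_
  · intro i hi
    simp at hi ⊢
    omega
  · intro i _ j _ h
    exact Fin.ext (by simpa using h)
  · intro b hb
    simp only [Finset.mem_Icc] at hb
    exact ⟨⟨b - 1, by omega⟩, by simp; omega, by simp; omega⟩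
  · intro i _
    have : 1 ≤ i.val + 1 ∧ i.val + 1 ≤ n := ⟨by omega, i.isLt⟩
    simp [nth, this]

theorem antitone_desc {n : ℕ} (y : Fin n → ℝ) : Antitone (desc y) := by
  intro i j h
  have := Tuple.monotone_sort (fun j => -y j) h
  simp only [Function.comp] at this
  simp only [desc]
  linarith

theorem antitone_eigs {n : ℕ} (X : Matrix (Fin n) (Fin n) ℝ) : Antitone (eigs X) := by
  unfold eigs
  split_ifs with h
  · exact fun i j hij => h.eigenvalues₀_antitone (by simpa using hij)
  · exact fun _ _ _ => le_rfl

theorem charpoly_roots_eq_eigs {n : ℕ} {X : Matrix (Fin n) (Fin n) ℝ} (hX : X.IsHermitian) :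
    X.charpoly.roots = Multiset.map (eigs X) Finset.univ.val := by
  rw [hX.roots_charpoly_eq_eigenvalues₀]
  have : eigs X = fun i => hX.eigenvalues₀ (Fin.castOrderIso (Fintype.card_fin n).symm i) := by
    unfold eigs
    rw [dif_pos hX]
    rfl
  rw [this]
  have h2 := Finset.map_univ_equiv (Fin.castOrderIso (Fintype.card_fin n).symm).toEquiv
  rw [← h2, Finset.map_val, Multiset.map_map]
  rfl

theorem eq_of_antitone_of_multiset_eq {n : ℕ} {f g : Fin n → ℝ} (hf : Antitone f)
    (hg : Antitone g)
    (h : Multiset.map f Finset.univ.val = Multiset.map g Finset.univ.val) : f = g := by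
  rw [← List.ofFn_inj]
  simp only [Fin.univ_val_map, Multiset.coe_eq_coe] at h
  exact h.eq_of_sortedGE hf.sortedGE_ofFn hg.sortedGE_ofFn

theorem eigs_eq_of_charpoly_eq {n : ℕ} {X Y : Matrix (Fin n) (Fin n) ℝ} (hX : X.IsHermitian)
    (hY : Y.IsHermitian) (h : X.charpoly = Y.charpoly) : eigs X = eigs Y :=
  eq_of_antitone_of_multiset_eq (antitone_eigs X) (antitone_eigs Y)
    (by rw [← charpoly_roots_eq_eigs hX, ← charpoly_roots_eq_eigs hY, h])

theorem isHermitian_conj_diagonal {n : ℕ} (Q : Matrix (Fin n) (Fin n) ℝ) (v : Fin n → ℝ) :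
    (Q * diagonal v * Qᵀ).IsHermitian := by
  simp [IsHermitian, conjTranspose_eq_transpose_of_trivial, Matrix.mul_assoc]

theorem posSemidef_conj_diagonal {n : ℕ} (Q : Matrix (Fin n) (Fin n) ℝ) {v : Fin n → ℝ}
    (hv : ∀ i, 0 ≤ v i) : (Q * diagonal v * Qᵀ).PosSemidef := by
  have := (PosSemidef.diagonal (n := Fin n) (d := v) hv).mul_mul_conjTranspose_same Q
  rwa [conjTranspose_eq_transpose_of_trivial] at this

/-- Permuting the diagonal leaves the multiset of characteristic roots unchanged. The permutation is
needed for the terms that Birkhoff's theorem produces. -/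
theorem eigs_conj_diagonal_comp_perm {n : ℕ} {Q : Matrix (Fin n) (Fin n) ℝ} (hQ : Qᵀ * Q = 1)
    {v : Fin n → ℝ} (hv : Antitone v) (σ : Equiv.Perm (Fin n)) :
    eigs (Q * diagonal (v ∘ σ) * Qᵀ) = v := by
  refine eq_of_antitone_of_multiset_eq (antitone_eigs _) hv ?_
  rw [← charpoly_roots_eq_eigs (isHermitian_conj_diagonal Q _), charpoly_mul_comm,
    ← Matrix.mul_assoc, hQ, Matrix.one_mul, charpoly_diagonal, Polynomial.roots_prod]
  · simp only [Polynomial.roots_X_sub_C, Multiset.bind_singleton]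
    conv_rhs => rw [← Finset.map_univ_equiv σ, Finset.map_val, Multiset.map_map]
    rfl
  · exact Finset.prod_ne_zero_iff.mpr fun i _ => Polynomial.X_sub_C_ne_zero _

theorem exists_orthogonal_diagonalization {n : ℕ} {X : Matrix (Fin n) (Fin n) ℝ}
    (hX : X.IsHermitian) :
    ∃ Q : Matrix (Fin n) (Fin n) ℝ, Qᵀ * Q = 1 ∧ Q * Qᵀ = 1 ∧ X = Q * diagonal (eigs X) * Qᵀ := by
  obtain ⟨U, hU⟩ : ∃ U : Matrix (Fin n) (Fin n) ℝ, U = ↑hX.eigenvectorUnitary := ⟨_, rfl⟩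
  -- `eigenvalues` lists the sorted spectrum through an arbitrary equivalence; `e` restores the
  -- decreasing order.
  let e : Equiv.Perm (Fin n) := (Fin.castOrderIso (Fintype.card_fin n).symm).toEquiv.trans
    (Fintype.equivOfCardEq (Fintype.card_fin _))
  have hUU : Uᵀ * U = 1 := by
    have := Unitary.coe_star_mul_self hX.eigenvectorUnitary
    rwa [star_eq_conjTranspose, conjTranspose_eq_transpose_of_trivial, ← hU] at this
  have hX' : X = U * diagonal hX.eigenvalues * Uᵀ := by
    have := hX.spectral_theorem
    rw [Unitary.conjStarAlgAut_apply, ← hU] at this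
    simpa [star_eq_conjTranspose, conjTranspose_eq_transpose_of_trivial] using! this
  have he : eigs X = hX.eigenvalues ∘ e := by
    unfold eigs
    rw [dif_pos hX]
    ext i
    simp [IsHermitian.eigenvalues, e]
  have hQ : (U.submatrix id e)ᵀ * U.submatrix id e = 1 := by
    have : (U.submatrix id e)ᵀ * U.submatrix id e = (Uᵀ * U).submatrix e e := by
      ext i j
      simp [Matrix.mul_apply]
    rw [this, hUU, submatrix_one_equiv]
  refine ⟨U.submatrix id e, hQ, mul_eq_one_comm.mp hQ, ?_⟩
  rw [he]
  conv_lhs => rw [hX']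
  ext i j
  rw [Matrix.mul_apply, Matrix.mul_apply]
  simp only [mul_diagonal, submatrix_apply, transpose_apply, id, Function.comp_apply]
  exact (Equiv.sum_comp e fun l => U i l * hX.eigenvalues l * U j l).symm

theorem eigs_nonneg {n : ℕ} {X : Matrix (Fin n) (Fin n) ℝ} (hX : X.PosSemidef) (i : Fin n) :
    0 ≤ eigs X i := by
  have h := hX.eigenvalues_nonneg ((Fintype.equivOfCardEq (Fintype.card_fin _))
    (Fin.cast (Fintype.card_fin n).symm i))
  unfold eigs
  rw [dif_pos hX.1]
  simpa [IsHermitian.eigenvalues] using h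

/-! ### Von Neumann's trace inequality -/

/-- Birkhoff's theorem reduces this to permutation matrices, where it is the rearrangement
inequality. -/
theorem sum_mul_le_sum_of_doublyStochastic {n : ℕ} {D : Matrix (Fin n) (Fin n) ℝ}
    (hD : D ∈ doublyStochastic ℝ (Fin n)) {a b : Fin n → ℝ} (ha : Antitone a) (hb : Monotone b) :
    ∑ i, a i * b i ≤ ∑ i, ∑ j, a i * D i j * b j := by
  obtain ⟨w, hw0, hw1, rfl⟩ := exists_eq_sum_perm_of_mem_doublyStochastic hD
  have key : ∀ σ : Equiv.Perm (Fin n), ∑ i, a i * b i ≤ ∑ i, a i * b (σ i) := fun σ =>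
    (ha.antivary hb).sum_mul_le_sum_mul_comp_perm
  have hval : ∑ i, ∑ j, a i * (∑ σ, w σ • σ.permMatrix ℝ) i j * b j
      = ∑ σ, w σ * ∑ i, a i * b (σ i) := by
    calc _ = ∑ i, ∑ j, ∑ σ, w σ * (a i * (if σ i = j then b j else 0)) := by
          refine Finset.sum_congr rfl fun i _ => Finset.sum_congr rfl fun j _ => ?_
          rw [Matrix.sum_apply, Finset.mul_sum, Finset.sum_mul]
          refine Finset.sum_congr rfl fun σ _ => ?_
          by_cases h : σ i = j <;>
            simp [Equiv.Perm.permMatrix, PEquiv.toMatrix_apply, h]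
          ring
      _ = ∑ i, ∑ σ, w σ * (a i * b (σ i)) := by
          refine Finset.sum_congr rfl fun i _ => ?_
          rw [Finset.sum_comm]
          refine Finset.sum_congr rfl fun σ _ => ?_
          rw [← Finset.mul_sum, ← Finset.mul_sum]
          simp
      _ = _ := by
          rw [Finset.sum_comm]
          simp only [Finset.mul_sum]
  rw [hval]
  calc _ = ∑ σ, w σ * ∑ i, a i * b i := by rw [← Finset.sum_mul, hw1, one_mul]
    _ ≤ _ := Finset.sum_le_sum fun σ _ => mul_le_mul_of_nonneg_left (key σ) (hw0 σ)

theorem sq_entries_mem_doublyStochastic {n : ℕ} {Q : Matrix (Fin n) (Fin n) ℝ}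
    (h1 : Qᵀ * Q = 1) : (of fun i j => Q i j ^ 2) ∈ doublyStochastic ℝ (Fin n) := by
  have h2 : Q * Qᵀ = 1 := mul_eq_one_comm.mp h1
  rw [mem_doublyStochastic_iff_sum]
  refine ⟨fun i j => by simp [sq_nonneg], fun i => ?_, fun j => ?_⟩
  · have := congrFun (congrFun h2 i) i
    simpa [Matrix.mul_apply, sq] using this
  · have := congrFun (congrFun h1 j) j
    simpa [Matrix.mul_apply, sq] using this

theorem trace_conj_diagonal_mul {n : ℕ} (P Q : Matrix (Fin n) (Fin n) ℝ) (a b : Fin n → ℝ) :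
    ((P * diagonal a * Pᵀ) * (Q * diagonal b * Qᵀ)).trace
      = ∑ i, ∑ j, a i * (Pᵀ * Q) i j ^ 2 * b j := by
  have : ((P * diagonal a * Pᵀ) * (Q * diagonal b * Qᵀ)).trace
      = (diagonal a * (Pᵀ * Q) * (diagonal b * (Pᵀ * Q)ᵀ)).trace := by
    rw [transpose_mul, transpose_transpose, Matrix.mul_assoc P, Matrix.mul_assoc P,
      Matrix.trace_mul_comm P]
    simp only [Matrix.mul_assoc]
  rw [this, trace]
  refine Finset.sum_congr rfl fun i _ => ?_
  rw [diag_apply, Matrix.mul_apply]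
  refine Finset.sum_congr rfl fun j _ => ?_
  rw [diagonal_mul, diagonal_mul, transpose_apply]
  ring

/-- von Neumann's trace inequality for oppositely sorted spectra. -/
theorem sum_eigs_mul_le_trace {n : ℕ} {Y Q : Matrix (Fin n) (Fin n) ℝ} (hY : Y.IsHermitian)
    (hQ : Qᵀ * Q = 1) {w : Fin n → ℝ} (hw : Monotone w) :
    ∑ i, eigs Y i * w i ≤ (Y * (Q * diagonal w * Qᵀ)).trace := by
  obtain ⟨P, hP, hP', hYP⟩ := exists_orthogonal_diagonalization hY
  have hR : (Pᵀ * Q)ᵀ * (Pᵀ * Q) = 1 := by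
    rw [transpose_mul, transpose_transpose, Matrix.mul_assoc, ← Matrix.mul_assoc P, hP',
      Matrix.one_mul, hQ]
  have h := sum_mul_le_sum_of_doublyStochastic (sq_entries_mem_doublyStochastic hR)
    (antitone_eigs Y) hw
  conv_rhs => rw [hYP]
  rw [trace_conj_diagonal_mul]
  exact h


theorem sum_ite_const {n m : ℕ} (a : ℕ) (ham : a ≤ m) (hm : m ≤ n) (c : ℝ) :
    ∑ i : Fin n, (if a ≤ i.val ∧ i.val < m then c else 0) = ((m : ℝ) - a) * c := by
  rw [← sum_Icc_nth a hm (0 : Fin n → ℝ) (fun _ => c)]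
  simp [Nat.cast_sub ham]

theorem weightedGram_eq {n : ℕ} (A : Matrix (Fin n) (Fin n) ℝ) (x : Fin n → ℝ) :
    weightedGram A x = A * diagonal x * Aᵀ := by
  ext i j
  rw [weightedGram, Matrix.sum_apply, Matrix.mul_apply]
  refine Finset.sum_congr rfl fun l _ => ?_
  simp [vecMulVec_apply]
  ring

/-! ### Bounds for the concave envelope -/

theorem concaveOn_const_add_trace {n : ℕ} (c : ℝ) (W : Matrix (Fin n) (Fin n) ℝ) :
    ConcaveOn ℝ {Y : Matrix (Fin n) (Fin n) ℝ | Y.PosSemidef} fun Y => c + (Y * W).trace := by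
  refine ⟨fun X hX Y hY a b ha hb _ => (hX.smul ha).add (hY.smul hb), ?_⟩
  intro X _ Y _ a b _ _ hab
  simp only [Matrix.add_mul, Matrix.smul_mul, trace_add, trace_smul, smul_eq_mul]
  have : c = a * c + b * c := by rw [← add_mul, hab, one_mul]
  linarith

theorem coe_sum_ereal {ι : Type*} (S : Finset ι) (f : ι → ℝ) :
    ((∑ i ∈ S, f i : ℝ) : EReal) = ∑ i ∈ S, (f i : EReal) := by
  classical
  induction S using Finset.induction_on with
  | empty => simp
  | insert a S ha ih => rw [Finset.sum_insert ha, Finset.sum_insert ha, EReal.coe_add, ih]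

theorem Phi_eq_sum {n s : ℕ} (hsn : s ≤ n) (t : ℝ) (X : Matrix (Fin n) (Fin n) ℝ) :
    Phi s t X
      = ∑ i : Fin n, if i.val < s then ENNReal.log (ENNReal.ofReal (eigs X i + t)) else 0 := by
  have := sum_Icc_nth 0 hsn (eigs X) (fun a => ENNReal.log (ENNReal.ofReal (a + t)))
  simpa [Phi] using this

/-- This is log(uw) ≤ uw - 1; for u ≤ 0 the left side is -∞. -/
theorem log_ofReal_le {u w : ℝ} (hw : 0 < w) :
    ENNReal.log (ENNReal.ofReal u) ≤ ((-Real.log w + u * w - 1 : ℝ) : EReal) := by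
  rcases le_or_gt u 0 with h | h
  · rw [ENNReal.log_ofReal, if_pos h]
    exact bot_le
  · rw [ENNReal.log_ofReal_of_pos h, EReal.coe_le_coe_iff]
    have := Real.log_le_sub_one_of_pos (mul_pos h hw)
    rw [Real.log_mul h.ne' hw.ne'] at this
    linarith

theorem le_concaveEnvelope {n : ℕ} (f : Matrix (Fin n) (Fin n) ℝ → EReal)
    {X : Matrix (Fin n) (Fin n) ℝ} (hX : X.PosSemidef) : f X ≤ concaveEnvelope f X :=
  le_iInf₂ fun _ hh => hh.2 X hX

theorem concaveEnvelope_le {n : ℕ} {f : Matrix (Fin n) (Fin n) ℝ → EReal}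
    {h : Matrix (Fin n) (Fin n) ℝ → ℝ}
    (hc : ConcaveOn ℝ {Y : Matrix (Fin n) (Fin n) ℝ | Y.PosSemidef} h)
    (hf : ∀ Y : Matrix (Fin n) (Fin n) ℝ, Y.PosSemidef → f Y ≤ (h Y : EReal))
    (X : Matrix (Fin n) (Fin n) ℝ) : concaveEnvelope f X ≤ (h X : EReal) :=
  iInf₂_le h ⟨hc, hf⟩

/-- The affine majorant of `Phi` with slope `w` along the eigenvectors of `Y`. -/
theorem concaveEnvelope_Phi_le {n s : ℕ} (hsn : s ≤ n) (t : ℝ) {w : Fin n → ℝ}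
    (hw : Monotone w) (hw0 : ∀ i, 0 < w i) {Y : Matrix (Fin n) (Fin n) ℝ} (hY : Y.PosSemidef) :
    concaveEnvelope (Phi s t) Y
      ≤ (((∑ i : Fin n, if i.val < s then -Real.log (w i) + t * w i - 1 else 0)
          + ∑ i, eigs Y i * w i : ℝ) : EReal) := by
  obtain ⟨Q, hQ, hQ', hYQ⟩ := exists_orthogonal_diagonalization hY.1
  set c : ℝ := ∑ i : Fin n, if i.val < s then -Real.log (w i) + t * w i - 1 else 0 with hc
  have hval : ∑ i, eigs Y i * w i = (Y * (Q * diagonal w * Qᵀ)).trace := by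
    conv_rhs => rw [hYQ, trace_conj_diagonal_mul, hQ]
    refine Finset.sum_congr rfl fun i _ => ?_
    rw [Finset.sum_eq_single i] <;> simp +contextual [eq_comm]
  rw [hval]
  -- The frame `Q` is fixed at the point `Y`; for every other `Z` the trace inequality compares the
  -- two eigenbases.
  refine concaveEnvelope_le (concaveOn_const_add_trace c (Q * diagonal w * Qᵀ))
    (fun Z hZ => ?_) Y
  have h1 := sum_eigs_mul_le_trace hZ.1 hQ hw
  have h2 : Phi s t Z ≤ ((∑ i : Fin n,
      (if i.val < s then -Real.log (w i) + (eigs Z i + t) * w i - 1 else 0) : ℝ) : EReal) := by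
    rw [Phi_eq_sum hsn, coe_sum_ereal]
    refine Finset.sum_le_sum fun i _ => ?_
    split_ifs
    · exact log_ofReal_le (hw0 i)
    · simp
  refine h2.trans (EReal.coe_le_coe_iff.mpr ?_)
  refine le_trans ?_ (add_le_add_right h1 c)
  rw [hc, ← Finset.sum_add_distrib]
  refine Finset.sum_le_sum fun i _ => ?_
  -- Indices beyond `s` contribute nothing to Φ_s and a nonnegative amount to the majorant.
  have := mul_nonneg (eigs_nonneg hZ i) (hw0 i).le
  split_ifs <;> linarith

/-- Serves only to exclude the value -∞ at a positive parameter. -/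
theorem coe_sum_log_le_concaveEnvelope_Phi {n s : ℕ} (hsn : s ≤ n) {t : ℝ} (ht : 0 < t)
    {Y : Matrix (Fin n) (Fin n) ℝ} (hY : Y.PosSemidef) :
    ((∑ i : Fin n, (if i.val < s then Real.log t else 0) : ℝ) : EReal)
      ≤ concaveEnvelope (Phi s t) Y := by
  refine le_trans ?_ (le_concaveEnvelope _ hY)
  rw [Phi_eq_sum hsn, coe_sum_ereal]
  refine Finset.sum_le_sum fun i _ => ?_
  split_ifs
  · rw [← ENNReal.log_ofReal_of_pos ht]
    exact ENNReal.log_le_log (ENNReal.ofReal_le_ofReal (by linarith [eigs_nonneg hY i]))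
  · simp

/-! ### Majorization and the lower bound at parameter 0 -/

/-- A vector whose entries from the `k`-th on are at most `m` and sum to `(s - k) m` is the image,
under a doubly stochastic matrix, of the vector with these entries replaced by `s - k` copies
of `m` and zeros. -/
theorem exists_doublyStochastic_mulVec_eq {n s k : ℕ} (hks : k < s) (hsn : s ≤ n)
    {β : Fin n → ℝ} (hβ : ∀ i, 0 ≤ β i) {m : ℝ} (hm : 0 < m)
    (hle : ∀ i : Fin n, k ≤ i.val → β i ≤ m)
    (hsum : ∑ i : Fin n, (if k ≤ i.val ∧ i.val < n then β i else 0) = ((s : ℝ) - k) * m) :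
    ∃ D ∈ doublyStochastic ℝ (Fin n),
      D *ᵥ (fun j => if j.val < s then (if j.val < k then β j else m) else 0) = β := by
  have hsk : (0 : ℝ) < (s : ℝ) - k := by
    have : (k : ℝ) < s := by exact_mod_cast hks
    linarith
  have hns : (0 : ℝ) ≤ (n : ℝ) - s := by
    have : (s : ℝ) ≤ n := by exact_mod_cast hsn
    linarith
  -- A row `i ≥ k` will be constant `p i` on columns `k, …, s-1` and constant `q i` on columns `s,
  -- …, n-1`; the entry sum and the row sum force these values.
  obtain ⟨p, hp⟩ : ∃ p : Fin n → ℝ, p = fun i => β i / (((s : ℝ) - k) * m) := ⟨_, rfl⟩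
  obtain ⟨q, hq⟩ : ∃ q : Fin n → ℝ, q = fun i => (1 - β i / m) / ((n : ℝ) - s) := ⟨_, rfl⟩
  have hp0 : ∀ i, 0 ≤ p i := fun i => by
    rw [hp]; exact div_nonneg (hβ i) (mul_pos hsk hm).le
  have hq0 : ∀ i : Fin n, k ≤ i.val → 0 ≤ q i := fun i hi => by
    rw [hq]
    exact div_nonneg (sub_nonneg.mpr ((div_le_one hm).mpr (hle i hi))) hns
  have hpm : ∀ i, ((s : ℝ) - k) * p i = β i / m := fun i => by
    rw [hp]; field_simp
  have hqm : ∀ i : Fin n, k ≤ i.val → ((n : ℝ) - s) * q i = 1 - β i / m := fun i hi => by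
    rcases hsn.lt_or_eq with h | h
    · have : (0 : ℝ) < (n : ℝ) - s := by
        have : (s : ℝ) < n := by exact_mod_cast h
        linarith
      rw [hq]
      field_simp
    -- For `s = n` the division in `q` is by zero. The last block is then empty, and the sum
    -- condition forces every tail entry to equal `m`, so both sides vanish.
    · have h1 : ∑ i : Fin n, (if k ≤ i.val ∧ i.val < n then m else 0) = ((n : ℝ) - k) * m :=
        sum_ite_const k (by omega) le_rfl m
      have hsn' : (s : ℝ) = n := by rw [h]
      have h2 := (Finset.sum_eq_sum_iff_of_le (s := Finset.univ)
        (f := fun i : Fin n => if k ≤ i.val ∧ i.val < n then β i else 0)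
        (g := fun i : Fin n => if k ≤ i.val ∧ i.val < n then m else 0)
        (fun j _ => by
          split_ifs with hj
          · exact hle j hj.1
          · exact le_rfl)).mp (by rw [h1, ← hsn']; exact hsum) i (Finset.mem_univ _)
      have hi' : k ≤ i.val ∧ i.val < n := ⟨hi, i.isLt⟩
      simp only [hi', and_self, if_true] at h2
      rw [h2, div_self hm.ne', hsn']
      simp
  refine ⟨of fun i j => if i.val < k then (if i = j then 1 else 0) else
    (if k ≤ j.val ∧ j.val < s then p i else 0) + (if s ≤ j.val ∧ j.val < n then q i else 0),
    mem_doublyStochastic_iff_sum.mpr ⟨?_, ?_, ?_⟩, ?_⟩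
  · intro i j
    rw [of_apply]
    split_ifs with h1 <;> first | positivity | skip
    all_goals first
      | exact add_nonneg (hp0 i) (hq0 i (by omega))
      | simpa using hp0 i
      | simpa using hq0 i (by omega)
  · intro i
    simp only [of_apply]
    split_ifs with h
    · simp
    · rw [Finset.sum_add_distrib, sum_ite_const k hks.le hsn, sum_ite_const s hsn le_rfl, hpm,
        hqm i (by omega)]
      ring
  · intro j
    simp only [of_apply]
    rcases lt_or_ge j.val k with hj | hj
    · rw [Finset.sum_eq_single j]
      · simp [hj]
      · intro i _ hij
        have h1 : ¬ (k ≤ j.val) := by omega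
        have h2 : ¬ (s ≤ j.val) := by omega
        simp [hij, h1, h2]
      · simp
    · have h0 : ∀ i : Fin n, (if i.val < k then (if i = j then (1 : ℝ) else 0) else
          (if k ≤ j.val ∧ j.val < s then p i else 0)
            + (if s ≤ j.val ∧ j.val < n then q i else 0))
          = if j.val < s then (if k ≤ i.val ∧ i.val < n then p i else 0)
            else (if k ≤ i.val ∧ i.val < n then q i else 0) := by
        intro i
        by_cases hi : i.val < k
        · have : i ≠ j := fun h => by rw [h] at hi; omega
          have h' : ¬ (k ≤ i.val) := by omega
          simp [hi, this, h']
        · have h' : k ≤ i.val := by omega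
          by_cases hjs : j.val < s
          · have : ¬ (s ≤ j.val) := by omega
            simp [hi, hj, h', hjs, this]
          · have : s ≤ j.val := by omega
            simp [hi, h', hjs, this]
      simp only [h0]
      by_cases hjs : j.val < s
      · simp only [hjs, if_true, hp]
        have : ∀ i : Fin n, (if k ≤ i.val ∧ i.val < n then β i / (((s : ℝ) - k) * m) else 0)
            = (if k ≤ i.val ∧ i.val < n then β i else 0) / (((s : ℝ) - k) * m) := fun i => by
          split_ifs <;> simp
        simp only [this]
        rw [← Finset.sum_div, hsum, div_self (mul_pos hsk hm).ne']
      · simp only [hjs, if_false, hq]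
        have hns' : (0 : ℝ) < (n : ℝ) - s := by
          have : (s : ℝ) < n := by exact_mod_cast (by omega : s < n)
          linarith
        have : ∀ i : Fin n, (if k ≤ i.val ∧ i.val < n then (1 - β i / m) / ((n : ℝ) - s) else 0)
            = ((if k ≤ i.val ∧ i.val < n then 1 else 0)
              - (if k ≤ i.val ∧ i.val < n then β i else 0) / m) / ((n : ℝ) - s) := fun i => by
          split_ifs <;> simp
        simp only [this]
        rw [← Finset.sum_div, Finset.sum_sub_distrib, ← Finset.sum_div, hsum,
          sum_ite_const k (by omega) le_rfl]
        field_simp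
        ring
  · ext i
    simp only [mulVec, dotProduct, of_apply]
    by_cases hi : i.val < k
    · have : i.val < s := by omega
      rw [Finset.sum_eq_single i] <;> simp +contextual [hi, this, eq_comm]
    · have h0 : ∀ j : Fin n, (if i.val < k then (if i = j then (1 : ℝ) else 0) else
          (if k ≤ j.val ∧ j.val < s then p i else 0)
            + (if s ≤ j.val ∧ j.val < n then q i else 0))
            * (if j.val < s then (if j.val < k then β j else m) else 0)
          = if k ≤ j.val ∧ j.val < s then p i * m else 0 := by
        intro j
        by_cases h1 : j.val < k
        · have h2 : ¬ (k ≤ j.val) := by omega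
          have h3 : ¬ (s ≤ j.val) := by omega
          simp [hi, h2, h3]
        · have h2 : k ≤ j.val := by omega
          by_cases h3 : j.val < s
          · have h4 : ¬ (s ≤ j.val) := by omega
            simp [hi, h1, h2, h3, h4]
          · simp [h3]
      simp only [h0]
      rw [sum_ite_const k hks.le hsn, ← mul_assoc, hpm, div_mul_cancel₀ _ hm.ne']

theorem mulVec_eq_sum_perm {n : ℕ} {w : Equiv.Perm (Fin n) → ℝ} (v : Fin n → ℝ) :
    (∑ σ, w σ • σ.permMatrix ℝ) *ᵥ v = ∑ σ, w σ • (v ∘ σ) := by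
  rw [Matrix.sum_mulVec]
  refine Finset.sum_congr rfl fun σ _ => ?_
  rw [smul_mulVec, permMatrix_mulVec]

theorem le_concaveEnvelope_Phi_zero {n s k : ℕ} (hks : k < s) (hsn : s ≤ n)
    {B : Matrix (Fin n) (Fin n) ℝ} (hB : B.PosSemidef) {m : ℝ} (hm : 0 < m)
    (hlt : ∀ i : Fin n, i.val < k → m < eigs B i)
    (hle : ∀ i : Fin n, k ≤ i.val → eigs B i ≤ m)
    (hsum : ∑ i : Fin n, (if k ≤ i.val ∧ i.val < n then eigs B i else 0) = ((s : ℝ) - k) * m) :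
    ((∑ i : Fin n, (if i.val < s then
        Real.log (if i.val < k then eigs B i else m) else 0) : ℝ) : EReal)
      ≤ concaveEnvelope (Phi s 0) B := by
  obtain ⟨D, hD, hDβ⟩ :=
    exists_doublyStochastic_mulVec_eq hks hsn (eigs_nonneg hB) hm hle hsum
  obtain ⟨c, hc0, hc1, rfl⟩ := exists_eq_sum_perm_of_mem_doublyStochastic hD
  obtain ⟨Q, hQ, -, hBQ⟩ := exists_orthogonal_diagonalization hB.1
  set ν : Fin n → ℝ := fun j => if j.val < s then (if j.val < k then eigs B j else m) else 0
    with hν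
  rw [mulVec_eq_sum_perm] at hDβ
  have hν0 : ∀ i, 0 ≤ ν i := fun i => by
    simp only [hν]
    split_ifs
    · exact eigs_nonneg hB i
    · exact hm.le
    · exact le_rfl
  have hνanti : Antitone ν := by
    intro i j hij
    have hij' : i.val ≤ j.val := hij
    rcases lt_or_ge j.val k with h1 | h1
    · have h2 : i.val < k := by omega
      have h3 : i.val < s := by omega
      have h4 : j.val < s := by omega
      simpa [hν, h1, h2, h3, h4] using antitone_eigs B hij
    · rcases lt_or_ge j.val s with h2 | h2
      · have h3 : i.val < s := by omega
        have h4 : ¬ (j.val < k) := by omega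
        simp only [hν, h2, h3, h4, if_true, if_false]
        split_ifs with h5
        · exact (hlt i h5).le
        · exact le_rfl
      · have : ν j = 0 := by simp [hν, Nat.not_lt.mpr h2]
        rw [this]
        exact hν0 i
  -- The convex combination of spectra is carried to matrices in the common eigenbasis `Q`.
  have hBsum : B = ∑ σ, c σ • (Q * diagonal (ν ∘ σ) * Qᵀ) := by
    conv_lhs => rw [hBQ, ← hDβ]
    have : diagonal (∑ σ, c σ • (ν ∘ σ)) = ∑ σ, c σ • diagonal (ν ∘ σ) := by
      ext i j
      by_cases hij : i = j <;> simp [Matrix.sum_apply, hij]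
    rw [this, Finset.mul_sum, Finset.sum_mul]
    simp
  have hPhi : ∀ σ : Equiv.Perm (Fin n), Phi s 0 (Q * diagonal (ν ∘ σ) * Qᵀ)
      = ((∑ i : Fin n, (if i.val < s then
        Real.log (if i.val < k then eigs B i else m) else 0) : ℝ) : EReal) := by
    intro σ
    rw [Phi_eq_sum hsn, coe_sum_ereal, eigs_conj_diagonal_comp_perm hQ hνanti]
    refine Finset.sum_congr rfl fun i _ => ?_
    by_cases h : i.val < s
    · have hpos : 0 < if i.val < k then eigs B i else m := by
        split_ifs with h'
        · exact hm.trans (hlt i h')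
        · exact hm
      simp only [hν, h, if_true, add_zero]
      exact ENNReal.log_ofReal_of_pos hpos
    · simp [h]
  -- Jensen's inequality for an arbitrary concave majorant `h`; all terms of the combination have
  -- the same Φ_s.
  refine le_iInf₂ fun h hh => EReal.coe_le_coe_iff.mpr ?_
  have hpsd : ∀ σ : Equiv.Perm (Fin n), (Q * diagonal (ν ∘ σ) * Qᵀ).PosSemidef := fun σ =>
    posSemidef_conj_diagonal Q fun i => hν0 (σ i)
  have hcon := hh.1.le_map_sum (t := Finset.univ) (w := c)
    (p := fun σ => Q * diagonal (ν ∘ σ) * Qᵀ) (fun σ _ => hc0 σ) hc1 (fun σ _ => hpsd σ)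
  rw [← hBsum] at hcon
  refine le_trans ?_ hcon
  have : ∀ σ ∈ Finset.univ, c σ • (∑ i : Fin n, (if i.val < s then
        Real.log (if i.val < k then eigs B i else m) else 0))
      ≤ c σ • h (Q * diagonal (ν ∘ σ) * Qᵀ) := fun σ _ => by
    refine mul_le_mul_of_nonneg_left ?_ (hc0 σ)
    have := hh.2 _ (hpsd σ)
    rw [hPhi σ] at this
    exact EReal.coe_le_coe_iff.mp this
  refine le_trans ?_ (Finset.sum_le_sum this)
  rw [← Finset.sum_smul, hc1, one_smul]


/-! ### Spectra of weighted Gram matrices and Ky Fan's principle -/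

theorem lambdaMin_pos {n : ℕ} (hn : 1 ≤ n) {C : Matrix (Fin n) (Fin n) ℝ} (hC : C.PosDef) :
    0 < lambdaMin C := by
  have h := hC.eigenvalues_pos ((Fintype.equivOfCardEq (Fintype.card_fin _))
    (Fin.cast (Fintype.card_fin n).symm ⟨n - 1, by omega⟩))
  have h2 : lambdaMin C = eigs C ⟨n - 1, by omega⟩ := by simp [lambdaMin, nth, hn]
  rw [h2]
  unfold eigs
  rw [dif_pos hC.1]
  simpa [IsHermitian.eigenvalues] using h

theorem posSemidef_weightedGram {n : ℕ} (A : Matrix (Fin n) (Fin n) ℝ) {x : Fin n → ℝ}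
    (hx : ∀ i, 0 ≤ x i) : (weightedGram A x).PosSemidef := by
  rw [weightedGram_eq]
  exact posSemidef_conj_diagonal A hx

/-- Cyclicity of the characteristic polynomial; afterwards the factor enters only through `Aᵀ * A`,
which is `C - t I`. -/
theorem eigs_weightedGram {n : ℕ} (A : Matrix (Fin n) (Fin n) ℝ) {x : Fin n → ℝ}
    (hx : ∀ i, 0 ≤ x i) :
    eigs (weightedGram A x)
      = eigs (diagonal (fun i => √(x i)) * (Aᵀ * A) * diagonal (fun i => √(x i))) := by
  have hd : diagonal x = diagonal (fun i => √(x i)) * diagonal (fun i => √(x i)) := by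
    rw [diagonal_mul_diagonal]
    congr 1
    ext i
    exact (Real.mul_self_sqrt (hx i)).symm
  refine eigs_eq_of_charpoly_eq (posSemidef_weightedGram A hx).1 ?_ ?_
  · simp [IsHermitian, conjTranspose_eq_transpose_of_trivial, Matrix.mul_assoc]
  · rw [weightedGram_eq, hd, ← Matrix.mul_assoc, Matrix.mul_assoc, charpoly_mul_comm]
    simp only [Matrix.mul_assoc]

theorem sum_eigs_le_trace {n : ℕ} {Y : Matrix (Fin n) (Fin n) ℝ} (hY : Y.IsHermitian) :
    ∑ i, eigs Y i ≤ Y.trace := by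
  have := sum_eigs_mul_le_trace (Q := 1) hY (by simp) (w := fun _ => 1) monotone_const
  simpa using this

theorem eigs_diagonal {n : ℕ} (x : Fin n → ℝ) : eigs (diagonal x) = desc x := by
  have h := eigs_conj_diagonal_comp_perm (Q := (1 : Matrix (Fin n) (Fin n) ℝ)) (by simp)
    (antitone_desc x) (Tuple.sort (fun j => -x j)).symm
  have h2 : desc x ∘ (Tuple.sort (fun j => -x j)).symm = x := by
    ext i
    simp [desc]
  simpa [h2] using h

/-- Ky Fan's maximum principle for a diagonal matrix. -/
theorem sum_rayleigh_le_sum_desc {n : ℕ} (x : Fin n → ℝ) {Q : Matrix (Fin n) (Fin n) ℝ}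
    (hQ : Qᵀ * Q = 1) (k : ℕ) :
    ∑ j : Fin n, (if j.val < k then ∑ i, x i * Q i j ^ 2 else 0)
      ≤ ∑ j : Fin n, (if j.val < k then desc x j else 0) := by
  -- Weights -1 on the first `k` places are increasing, so the trace inequality, negated, is Ky
  -- Fan's bound.
  have hmono : Monotone fun j : Fin n => if j.val < k then (-1 : ℝ) else 0 := by
    intro i j hij
    have : i.val ≤ j.val := hij
    dsimp only
    split_ifs <;> first | omega | norm_num
  have h := sum_eigs_mul_le_trace (isHermitian_diagonal x) hQ hmono
  have h1 := trace_conj_diagonal_mul 1 Q x (fun j : Fin n => if j.val < k then (-1 : ℝ) else 0)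
  simp only [Matrix.one_mul, transpose_one, Matrix.mul_one] at h1
  rw [h1, eigs_diagonal, Finset.sum_comm] at h
  have e1 : ∑ j : Fin n, desc x j * (if j.val < k then (-1 : ℝ) else 0)
      = -∑ j : Fin n, (if j.val < k then desc x j else 0) := by
    rw [← Finset.sum_neg_distrib]
    exact Finset.sum_congr rfl fun j _ => by split_ifs <;> simp
  have e2 : ∑ j : Fin n, ∑ i, x i * Q i j ^ 2 * (if j.val < k then (-1 : ℝ) else 0)
      = -∑ j : Fin n, (if j.val < k then ∑ i, x i * Q i j ^ 2 else 0) := by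
    rw [← Finset.sum_neg_distrib]
    refine Finset.sum_congr rfl fun j _ => ?_
    split_ifs <;> simp
  rw [e1, e2] at h
  linarith

/-- Serves only for finiteness: with slope 1 the majorant depends on the trace, which is bounded
because x ≤ 1. -/
theorem exists_bound_zero_le {n s : ℕ} (hsn : s ≤ n) (A : Matrix (Fin n) (Fin n) ℝ) :
    ∃ c : ℝ, bound s A 0 ≤ (c : EReal) := by
  refine ⟨(∑ i : Fin n, if i.val < s then -Real.log 1 + 0 * 1 - 1 else 0)
    + ∑ i, ∑ j, A j i * A j i, iSup₂_le fun x hx => ?_⟩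
  have hpsd := posSemidef_weightedGram A fun i => (hx.1 i).1
  refine (concaveEnvelope_Phi_le hsn 0 (w := fun _ => 1) monotone_const (fun _ => one_pos)
    hpsd).trans (EReal.coe_le_coe_iff.mpr (add_le_add_right ?_ _))
  simp only [mul_one]
  refine (sum_eigs_le_trace hpsd.1).trans ?_
  rw [weightedGram, trace_sum]
  refine Finset.sum_le_sum fun i _ => ?_
  rw [trace_smul, trace_vecMulVec, smul_eq_mul]
  exact mul_le_of_le_one_left (Finset.sum_nonneg fun j _ => mul_self_nonneg _) (hx.1 i).2

/-! ### The slopes of the majorant and the gap -/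

/-- The increasing slopes `1 / β_i` for `i ≤ k` and `1 / m` for `i > k`. -/
noncomputable def majorantSlope {n : ℕ} (k : ℕ) (β : Fin n → ℝ) (m : ℝ) (i : Fin n) : ℝ :=
  (if i.val < k then β i else m)⁻¹

theorem slope_pos {n k : ℕ} {β : Fin n → ℝ} {m : ℝ} (hm : 0 < m)
    (hlt : ∀ i : Fin n, i.val < k → m < β i) (i : Fin n) : 0 < majorantSlope k β m i := by
  unfold majorantSlope
  split_ifs with h
  · exact inv_pos.mpr (hm.trans (hlt i h))
  · exact inv_pos.mpr hm

theorem monotone_slope {n k : ℕ} {β : Fin n → ℝ} (hβ : Antitone β) {m : ℝ} (hm : 0 < m)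
    (hlt : ∀ i : Fin n, i.val < k → m < β i) : Monotone (majorantSlope k β m) := by
  intro i j hij
  have hij' : i.val ≤ j.val := hij
  unfold majorantSlope
  split_ifs with h1 h2 h2
  · exact inv_anti₀ (hm.trans (hlt j h2)) (hβ hij)
  · exact inv_anti₀ hm (hlt i h1).le
  · omega
  · exact le_rfl

/-- The first `k` terms are 1 and the tail gives (s-k)m/m. This total cancels the `s` terms -1 of
the majorant. -/
theorem sum_mul_slope {n s k : ℕ} (hkn : k ≤ n) {β : Fin n → ℝ} {m : ℝ} (hm : 0 < m)
    (hlt : ∀ i : Fin n, i.val < k → m < β i)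
    (hsum : ∑ i : Fin n, (if k ≤ i.val ∧ i.val < n then β i else 0) = ((s : ℝ) - k) * m) :
    ∑ i, β i * majorantSlope k β m i = s := by
  have h : ∀ i : Fin n, β i * majorantSlope k β m i = (if 0 ≤ i.val ∧ i.val < k then 1 else 0)
      + (if k ≤ i.val ∧ i.val < n then β i else 0) * m⁻¹ := fun i => by
    unfold majorantSlope
    by_cases hi : i.val < k
    · have h1 : ¬ (k ≤ i.val) := by omega
      simp [hi, h1, mul_inv_cancel₀ (hm.trans (hlt i hi)).ne']
    · have h1 : k ≤ i.val := by omega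
      simp [hi, h1]
  simp only [h]
  rw [Finset.sum_add_distrib, ← Finset.sum_mul, hsum, sum_ite_const 0 (Nat.zero_le _) hkn]
  field_simp
  push_cast
  ring

/-- A constant slope 1/m would contribute s/m to both sums and cancel; only the deviations from it
at the first `k` places survive. -/
theorem mul_slope_sum_gap {n s k : ℕ} (hks : k < s) (hsn : s ≤ n) {β : Fin n → ℝ} {m : ℝ}
    {y : Fin n → ℝ} (hysum : ∑ i, y i = s) :
    ∑ i, y i * majorantSlope k β m i - ∑ i : Fin n, (if i.val < s then majorantSlope k β m i else 0)
      = ∑ i : Fin n, if i.val < k then (m⁻¹ - (β i)⁻¹) * (1 - y i) else 0 := by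
  have h : ∀ i : Fin n, y i * majorantSlope k β m i - (if i.val < s then majorantSlope k β m i else 0)
      = y i * m⁻¹ - (if 0 ≤ i.val ∧ i.val < s then m⁻¹ else 0)
        + (if i.val < k then (m⁻¹ - (β i)⁻¹) * (1 - y i) else 0) := fun i => by
    unfold majorantSlope
    by_cases hi : i.val < k
    · have : i.val < s := by omega
      simp only [hi, this, if_true, Nat.zero_le, true_and]
      ring
    · by_cases his : i.val < s <;> simp [hi, his]
  rw [← Finset.sum_sub_distrib, Finset.sum_congr rfl fun i _ => h i, Finset.sum_add_distrib,
    Finset.sum_sub_distrib, ← Finset.sum_mul, hysum, sum_ite_const 0 (Nat.zero_le _) hsn]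
  push_cast
  ring

theorem le_nth_of_lt {n k : ℕ} {y : Fin n → ℝ} (hy : Antitone y) (hkn : k ≤ n) {i : Fin n}
    (hi : i.val < k) : nth y k ≤ y i := by
  have h : 1 ≤ k ∧ k ≤ n := ⟨by omega, hkn⟩
  rw [nth, dif_pos h]
  exact hy (show i.val ≤ k - 1 by omega)

theorem le_nth_succ {n k : ℕ} {y : Fin n → ℝ} (hy : Antitone y) {i : Fin n}
    (hi : k ≤ i.val) : y i ≤ nth y (k + 1) := by
  have h : 1 ≤ k + 1 ∧ k + 1 ≤ n := ⟨by omega, by omega⟩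
  rw [nth, dif_pos h]
  exact hy (show k + 1 - 1 ≤ i.val by omega)

theorem desc_le_one {n : ℕ} {x : Fin n → ℝ} (hx : ∀ i, x i ≤ 1) (i : Fin n) : desc x i ≤ 1 :=
  hx _

theorem sum_Icc_desc {n k : ℕ} (hkn : k ≤ n) (x : Fin n → ℝ) :
    ∑ i ∈ Finset.Icc 1 k, nth (desc x) i = ∑ i : Fin n, if i.val < k then desc x i else 0 := by
  simpa using sum_Icc_nth 0 hkn (desc x) id

theorem sub_sum_desc_eq {n k : ℕ} (hkn : k ≤ n) (x : Fin n → ℝ) :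
    (k : ℝ) - ∑ i ∈ Finset.Icc 1 k, nth (desc x) i
      = ∑ i : Fin n, if i.val < k then 1 - desc x i else 0 := by
  have h := sum_ite_const 0 (Nat.zero_le k) hkn 1
  simp only [Nat.zero_le, true_and, Nat.cast_zero, sub_zero, mul_one] at h
  rw [sum_Icc_desc hkn, ← h, ← Finset.sum_sub_distrib]
  exact Finset.sum_congr rfl fun i _ => by split_ifs <;> simp

theorem sub_sum_desc_nonneg {n k : ℕ} (hkn : k ≤ n) {x : Fin n → ℝ} (hx : ∀ i, x i ≤ 1) :
    0 ≤ (k : ℝ) - ∑ i ∈ Finset.Icc 1 k, nth (desc x) i := by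
  rw [sub_sum_desc_eq hkn]
  refine Finset.sum_nonneg fun i _ => ?_
  split_ifs
  · linarith [desc_le_one hx i]
  · exact le_rfl

theorem sub_sum_desc_pos {n k : ℕ} (hk : 1 ≤ k) (hkn : k ≤ n) {x : Fin n → ℝ}
    (hx : ∀ i, x i ≤ 1) (hlt : nth (desc x) k < 1) :
    0 < (k : ℝ) - ∑ i ∈ Finset.Icc 1 k, nth (desc x) i := by
  rw [sub_sum_desc_eq hkn]
  refine Finset.sum_pos' (fun i _ => ?_) ⟨⟨k - 1, by omega⟩, Finset.mem_univ _, ?_⟩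
  · split_ifs
    · linarith [desc_le_one hx i]
    · exact le_rfl
  · rw [nth, dif_pos ⟨hk, hkn⟩] at hlt
    have : k - 1 < k := by omega
    simpa [this] using hlt

/-! ### Compression by √x -/

theorem conj_apply_self {n : ℕ} (Q M : Matrix (Fin n) (Fin n) ℝ) (i : Fin n) :
    (Qᵀ * (Mᵀ * M) * Q) i i = ∑ j, (M * Q) j i ^ 2 := by
  have : Qᵀ * (Mᵀ * M) * Q = (M * Q)ᵀ * (M * Q) := by
    rw [transpose_mul]
    simp only [Matrix.mul_assoc]
  rw [this, Matrix.mul_apply]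
  exact Finset.sum_congr rfl fun j _ => by rw [transpose_apply, sq]

theorem sqrt_conj_eq {n : ℕ} (C : Matrix (Fin n) (Fin n) ℝ) (t : ℝ) {x : Fin n → ℝ}
    (hx : ∀ i, 0 ≤ x i) :
    diagonal (fun i => √(x i)) * (C - t • (1 : Matrix (Fin n) (Fin n) ℝ))
        * diagonal (fun i => √(x i))
      = diagonal (fun i => √(x i)) * C * diagonal (fun i => √(x i)) - t • diagonal x := by
  ext i j
  by_cases h : i = j
  · subst h
    simp only [mul_diagonal, diagonal_mul, Matrix.sub_apply, Matrix.smul_apply, one_apply_eq,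
      diagonal_apply_eq, smul_eq_mul]
    linear_combination (-t) * Real.mul_self_sqrt (hx i)
  · simp [mul_diagonal, diagonal_mul, h]

/-- If `C - t I` is a Gram matrix, then the eigenvalues of the compression of `C` by `√x`
dominate `t` times the Rayleigh quotients of `x` along its eigenvectors. -/
theorem mul_rayleigh_le {n : ℕ} {C A Q : Matrix (Fin n) (Fin n) ℝ} {t : ℝ} {x β : Fin n → ℝ}
    (hx : ∀ i, 0 ≤ x i) (hA : C - t • (1 : Matrix (Fin n) (Fin n) ℝ) = Aᵀ * A)
    (hQ : Qᵀ * Q = 1)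
    (hβ : diagonal (fun i => √(x i)) * C * diagonal (fun i => √(x i)) = Q * diagonal β * Qᵀ)
    (i : Fin n) : t * ∑ j, x j * Q j i ^ 2 ≤ β i := by
  have h := sqrt_conj_eq C t hx
  rw [hA, hβ] at h
  have h1 := conj_apply_self Q (A * diagonal fun i => √(x i)) i
  have h2 : (A * diagonal fun i => √(x i))ᵀ * (A * diagonal fun i => √(x i))
      = Q * diagonal β * Qᵀ - t • diagonal x := by
    rw [← h, transpose_mul, diagonal_transpose]
    simp only [Matrix.mul_assoc]
  have h3 : Qᵀ * (Q * diagonal β * Qᵀ - t • diagonal x) * Q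
      = diagonal β - t • (Qᵀ * diagonal x * Q) := by
    rw [Matrix.mul_sub, Matrix.sub_mul, Matrix.mul_smul, Matrix.smul_mul]
    congr 1
    rw [← Matrix.mul_assoc, ← Matrix.mul_assoc, hQ, Matrix.one_mul, Matrix.mul_assoc, hQ,
      Matrix.mul_one]
  have h4 : (Qᵀ * diagonal x * Q) i i = ∑ j, x j * Q j i ^ 2 := by
    rw [Matrix.mul_apply]
    refine Finset.sum_congr rfl fun j _ => ?_
    rw [mul_diagonal, transpose_apply]
    ring
  rw [h2, h3, Matrix.sub_apply, diagonal_apply_eq, Matrix.smul_apply, h4, smul_eq_mul] at h1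
  have : 0 ≤ ∑ j, ((A * diagonal fun i => √(x i)) * Q) j i ^ 2 :=
    Finset.sum_nonneg fun j _ => sq_nonneg _
  linarith

end AugFact

/-! ### Assembly of the two bounds -/

theorem theorem3 (n s : ℕ) (hs : 1 ≤ s) (hsn : s ≤ n)
    (C : Matrix (Fin n) (Fin n) ℝ) (hC : C.PosDef)
    (A : ℝ → Matrix (Fin n) (Fin n) ℝ)
    (hA : ∀ t : ℝ, 0 ≤ t → t ≤ AugFact.lambdaMin C →
      C - t • (1 : Matrix (Fin n) (Fin n) ℝ) = (A t).transpose * A t)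
    (x : Fin n → ℝ)
    (hx : AugFact.IsOptimal s (A (AugFact.lambdaMin C)) (AugFact.lambdaMin C) x)
    (β : Fin n → ℝ) (hβ : β = AugFact.eigs (AugFact.weightedGram (A 0) x))
    (k : ℕ) (hk : AugFact.IsIndex s β k) :
    ∃ z₀ z₁ : ℝ,
      AugFact.bound s (A 0) 0 = (z₀ : EReal) ∧
      AugFact.bound s (A (AugFact.lambdaMin C)) (AugFact.lambdaMin C) = (z₁ : EReal) ∧
      (z₀ - z₁ ≥ AugFact.deltaLb s k (AugFact.lambdaMin C) x β ∧
        AugFact.deltaLb s k (AugFact.lambdaMin C) x β ≥ 0) ∧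
      (1 ≤ k → AugFact.nth (AugFact.desc x) k < 1 → z₁ < z₀) := by
  open AugFact Matrix in
  obtain ⟨hks, hk1, hk2⟩ := hk
  have hkn : k ≤ n := by omega
  have hl : 0 < lambdaMin C := lambdaMin_pos (hs.trans hsn) hC
  set t := lambdaMin C with ht
  obtain ⟨⟨hx01, hxs⟩, hxmax⟩ := hx
  have hx0 : ∀ i, 0 ≤ x i := fun i => (hx01 i).1
  have hx1 : ∀ i, x i ≤ 1 := fun i => (hx01 i).2
  have hA0 : (A 0)ᵀ * A 0 = C := by simpa using (hA 0 le_rfl hl.le).symm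
  have hAt := hA t hl.le le_rfl
  have hβanti : Antitone β := hβ ▸ antitone_eigs _
  have hsk : (0 : ℝ) < (s : ℝ) - k := by
    have : (k : ℝ) < s := by exact_mod_cast hks
    linarith
  -- spectral decomposition of the compression of `C`
  obtain ⟨B, hB⟩ : ∃ B, B = diagonal (fun i => √(x i)) * C * diagonal (fun i => √(x i)) :=
    ⟨_, rfl⟩
  have hBβ : eigs B = β := by rw [hβ, eigs_weightedGram _ hx0, hA0, hB]
  have hBherm : B.IsHermitian := by
    have : Cᵀ = C := by
      rw [← conjTranspose_eq_transpose_of_trivial]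
      exact hC.1
    simp [hB, IsHermitian, conjTranspose_eq_transpose_of_trivial, Matrix.mul_assoc, this]
  obtain ⟨Q, hQ, hQ', hBQ⟩ := exists_orthogonal_diagonalization hBherm
  rw [hBβ] at hBQ
  obtain ⟨y, hy⟩ : ∃ y : Fin n → ℝ, y = fun i => ∑ j, x j * Q j i ^ 2 := ⟨_, rfl⟩
  have hyβ : ∀ i, t * y i ≤ β i := fun i => by
    rw [hy]
    exact mul_rayleigh_le hx0 hAt hQ (hB ▸ hBQ) i
  have hDS := mem_doublyStochastic_iff_sum.mp (sq_entries_mem_doublyStochastic hQ)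
  have hy1 : ∀ i, y i ≤ 1 := fun i => by
    rw [hy, ← hDS.2.2 i]
    exact Finset.sum_le_sum fun j _ => mul_le_of_le_one_left (sq_nonneg _) (hx1 j)
  have hysum : ∑ i, y i = s := by
    rw [hy, Finset.sum_comm, ← hxs]
    refine Finset.sum_congr rfl fun j _ => ?_
    have := hDS.2.1 j
    simp only [of_apply] at this
    rw [← Finset.mul_sum, this, mul_one]
  -- the tail mean
  have htail : tailSum β k = ∑ i : Fin n, if k ≤ i.val ∧ i.val < n then β i else 0 :=
    sum_Icc_nth k le_rfl β id
  -- From t y_i ≤ β_i, y_i ≤ 1 and Σ y_i = s, the tail is at least t(s-k).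
  have htail_pos : 0 < tailSum β k := by
    have h1 : ∑ i : Fin n, t * y i ≤ ∑ i : Fin n, ((if 0 ≤ i.val ∧ i.val < k then t else 0)
        + if k ≤ i.val ∧ i.val < n then β i else 0) := by
      refine Finset.sum_le_sum fun i _ => ?_
      by_cases hi : i.val < k
      · have h2 : ¬ (k ≤ i.val) := by omega
        simpa [hi, h2] using mul_le_of_le_one_right hl.le (hy1 i)
      · have h2 : k ≤ i.val := by omega
        simpa [hi, h2] using hyβ i
    rw [Finset.sum_add_distrib, ← htail, sum_ite_const 0 (Nat.zero_le _) hkn, ← Finset.mul_sum,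
      hysum] at h1
    have := mul_pos hsk hl
    push_cast at h1
    linarith
  obtain ⟨m, hm⟩ : ∃ m : ℝ, m = 1 / ((s : ℝ) - k) * tailSum β k := ⟨_, rfl⟩
  rw [← hm] at hk1 hk2
  have hm0 : 0 < m := by rw [hm]; positivity
  have hsum : ∑ i : Fin n, (if k ≤ i.val ∧ i.val < n then β i else 0) = ((s : ℝ) - k) * m := by
    rw [← htail, hm]
    field_simp
  have hlt : ∀ i : Fin n, i.val < k → m < β i := fun i hi =>
    (hk1 (by omega)).trans_le (le_nth_of_lt hβanti hkn hi)
  have hle : ∀ i : Fin n, k ≤ i.val → β i ≤ m := fun i hi =>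
    (le_nth_succ hβanti hi).trans hk2
  have hwmono := monotone_slope hβanti hm0 hlt
  have hwpos := slope_pos hm0 hlt
  -- the gap
  have hminv : ((s : ℝ) - k) / tailSum β k = m⁻¹ := by
    rw [hm, one_div, mul_inv, inv_inv, div_eq_mul_inv]
  have hdelta : deltaLb s k t x β
      = t * ((k : ℝ) - ∑ i ∈ Finset.Icc 1 k, nth (desc x) i) * (m⁻¹ - 1 / nth β k) := by
    rw [deltaLb, hminv]
  have hfac : 1 ≤ k → 0 < m⁻¹ - 1 / nth β k := fun h => by
    rw [one_div, sub_pos]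
    exact inv_strictAnti₀ hm0 (hk1 h)
  have hdelta0 : 0 ≤ deltaLb s k t x β := by
    rw [hdelta]
    -- For k = 0 the factor k - Σ_{i≤k} x↓_i is an empty difference.
    rcases Nat.eq_zero_or_pos k with h | h
    · simp [h]
    · exact mul_nonneg (mul_nonneg hl.le (sub_sum_desc_nonneg hkn hx1)) (hfac h).le
  have hgap : deltaLb s k t x β ≤ t * (∑ i, y i * majorantSlope k β m i
      - ∑ i : Fin n, (if i.val < s then majorantSlope k β m i else 0)) := by
    rw [mul_slope_sum_gap hks hsn hysum, hdelta, mul_assoc]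
    refine mul_le_mul_of_nonneg_left ?_ hl.le
    rcases Nat.eq_zero_or_pos k with h | h
    · simp [h]
    have hfan := sum_rayleigh_le_sum_desc x hQ k
    rw [← sum_Icc_desc hkn] at hfan
    have hcard := sum_ite_const 0 (Nat.zero_le k) hkn 1
    simp only [Nat.zero_le, true_and, Nat.cast_zero, sub_zero, mul_one] at hcard
    have h1 : (k : ℝ) - ∑ i ∈ Finset.Icc 1 k, nth (desc x) i
        ≤ ∑ i : Fin n, if i.val < k then 1 - y i else 0 := by
      have : ∑ i : Fin n, (if i.val < k then 1 - y i else 0)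
          = k - ∑ i : Fin n, (if i.val < k then y i else 0) := by
        rw [← hcard, ← Finset.sum_sub_distrib]
        exact Finset.sum_congr rfl fun i _ => by split_ifs <;> simp
      rw [this, hy]
      linarith
    refine (mul_le_mul_of_nonneg_right h1 (hfac h).le).trans ?_
    rw [Finset.sum_mul]
    refine Finset.sum_le_sum fun i _ => ?_
    split_ifs with hi
    · rw [mul_comm, one_div]
      -- β_k is the smallest of the first `k` entries, so 1/m - 1/β_k is the least coefficient.
      refine mul_le_mul_of_nonneg_right (sub_le_sub_left ?_ _) (sub_nonneg.mpr (hy1 i))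
      exact inv_anti₀ (hm0.trans (hk1 h)) (le_nth_of_lt hβanti hkn hi)
    · simp
  -- the lower bound at `0`
  obtain ⟨L, hL⟩ : ∃ L : ℝ, L = ∑ i : Fin n, (if i.val < s then
      Real.log (if i.val < k then β i else m) else 0) := ⟨_, rfl⟩
  have hpsd0 := posSemidef_weightedGram (A 0) hx0
  have hz0 : (L : EReal) ≤ bound s (A 0) 0 := by
    have h := le_concaveEnvelope_Phi_zero hks hsn hpsd0 hm0 (hβ ▸ hlt) (hβ ▸ hle) (hβ ▸ hsum)
    rw [← hβ, ← hL] at h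
    exact h.trans (le_iSup₂ (f := fun x (_ : x ∈ feasible n s) => objective s (A 0) 0 x) x
      ⟨hx01, hxs⟩)
  obtain ⟨c, hc⟩ := exists_bound_zero_le hsn (A 0)
  -- the upper bound at `t`
  have hpsdt := posSemidef_weightedGram (A t) hx0
  -- The only use of optimality; at parameter 0 feasibility of `x` suffices.
  have hz1eq : bound s (A t) t = objective s (A t) t x :=
    le_antisymm (iSup₂_le fun x' hx' => hxmax hx')
      (le_iSup₂ (f := fun x (_ : x ∈ feasible n s) => objective s (A t) t x) x ⟨hx01, hxs⟩)
  have hz1 : bound s (A t) t ≤ ((L - deltaLb s k t x β : ℝ) : EReal) := by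
    rw [hz1eq]
    refine (concaveEnvelope_Phi_le hsn t hwmono hwpos hpsdt).trans
      (EReal.coe_le_coe_iff.mpr ?_)
    rw [eigs_weightedGram _ hx0, ← hAt, sqrt_conj_eq C t hx0, ← hB]
    have hherm : (B - t • diagonal x).IsHermitian := by
      refine hBherm.sub ?_
      simp [IsHermitian]
    -- The frame is the eigenbasis of `B`, not of B - tX: the trace then splits into `s` and -t Σ
    -- y_i w_i.
    have h1 := sum_eigs_mul_le_trace hherm hQ hwmono
    have h2 := trace_conj_diagonal_mul 1 Q x (majorantSlope k β m)
    simp only [Matrix.one_mul, transpose_one, Matrix.mul_one] at h2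
    have h3 : ∑ i, ∑ j, x i * Q i j ^ 2 * majorantSlope k β m j = ∑ j, y j * majorantSlope k β m j := by
      rw [Finset.sum_comm, hy]
      exact Finset.sum_congr rfl fun j _ => by rw [Finset.sum_mul]
    have h4 : (B * (Q * diagonal (majorantSlope k β m) * Qᵀ)).trace = s := by
      rw [hBQ, trace_conj_diagonal_mul, hQ, ← sum_mul_slope hkn hm0 hlt hsum]
      refine Finset.sum_congr rfl fun i _ => ?_
      rw [Finset.sum_eq_single i] <;> simp +contextual [eq_comm]
    rw [Matrix.sub_mul, Matrix.smul_mul, trace_sub, trace_smul, h2, h3, h4, smul_eq_mul] at h1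
    have h5 : ∑ i : Fin n, (if i.val < s then
        -Real.log (majorantSlope k β m i) + t * majorantSlope k β m i - 1 else 0)
        = L + t * ∑ i : Fin n, (if i.val < s then majorantSlope k β m i else 0) - s := by
      have hcard := sum_ite_const 0 (Nat.zero_le s) hsn 1
      simp only [Nat.zero_le, true_and, Nat.cast_zero, sub_zero, mul_one] at hcard
      rw [hL, ← hcard, Finset.mul_sum, ← Finset.sum_add_distrib, ← Finset.sum_sub_distrib]
      refine Finset.sum_congr rfl fun i _ => ?_
      unfold majorantSlope
      rw [Real.log_inv, neg_neg]
      split_ifs <;> ring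
    rw [h5]
    linarith
  have hz1low : ((∑ i : Fin n, (if i.val < s then Real.log t else 0) : ℝ) : EReal)
      ≤ bound s (A t) t := by
    rw [hz1eq]
    exact coe_sum_log_le_concaveEnvelope_Phi hsn hl hpsdt
  have hz0real := EReal.coe_toReal (ne_top_of_le_ne_top (EReal.coe_ne_top c) hc)
    (ne_bot_of_le_ne_bot (EReal.coe_ne_bot L) hz0)
  have hz1real := EReal.coe_toReal (ne_top_of_le_ne_top (EReal.coe_ne_top _) hz1)
    (ne_bot_of_le_ne_bot (EReal.coe_ne_bot _) hz1low)
  rw [← hz0real, EReal.coe_le_coe_iff] at hz0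
  rw [← hz1real, EReal.coe_le_coe_iff] at hz1
  refine ⟨_, _, hz0real.symm, hz1real.symm, ⟨by linarith, hdelta0⟩, fun hk' hlt' => ?_⟩
  have : 0 < deltaLb s k t x β := by
    rw [hdelta]
    exact mul_pos (mul_pos hl (sub_sum_desc_pos hk' hkn hx1 hlt')) (hfac hk')
  linarith
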